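/- Let $k\ge 2$ and $\chi\ge 3$ be integers with $(\chi,k)\notin\{(3,2),(3,3)\}$. Let $X$ be a finite simple graph with chromatic number $\chi$, all of whose odd cycles (if any) have length at least $2k+1$. Then \[ |V(X)| \;\ge\; \frac{(\chi+k-2)(\chi+k-1)\cdots(\chi+2k-3)}{2^{k-1}k^k} + 2\binom{k-2+\lfloor\frac{\chi-1}{2}\rfloor}{\lfloor\frac{\chi-1}{2}\rfloor} + \binom{k-2+\lfloor\frac{\chi-1}{2}\rfloor}{\lfloor\frac{\chi-1}{2}\rfloor-1} + 1, \] where the numerator of the fraction is the product of the $k$ consecutive integers from $\chi+k-2$ to $\chi+2k-3$. -/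

import Mathlib

/-!
The proof estimates the growth of balls. Let `G` have no odd closed walk shorter than `2k + 1`, so
that inside a ball of radius `r < k` the parity of the distance to the centre is a proper
2-colouring (`SimpleGraph.even_dist_iff_not_of_adj`).

Fix `p ≥ 2` and let `W` be a smallest vertex set whose complement has a proper `p`-colouring `c`.
Take any ball `B` of radius `r < k`, and recolour `B` with two of the `p` colours by parity,
giving colour `j` to the outermost layer. The only conflicts are with the vertices of the next
layer outside `W` whose colour is `j`; uncolouring these frees all of `B ∩ W`. Minimality of `W`
therefore says that each of the `p` colours occurs at least `|B ∩ W|` times in the next layer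
(`SimpleGraph.card_inter_closedBall_le`), so passing from radius `r` to `r + 1` adds at least
`p * |B ∩ W|` vertices outside `W` (`SimpleGraph.card_closedBall_sdiff_add_le`).

Since `G[W]` needs at least `χ(G) - p` colours, this can be iterated. With `p = 2` at each step it
is a Pascal-type recursion: if `G` is not `2m`-colourable, then some ball of radius `k` has at
least `2 * (m + k).choose k - 1` vertices
(`SimpleGraph.exists_two_mul_choose_le_card_closedBall`). For `χ ≥ 5` and `m = ⌊(χ - 1) / 2⌋` this
suffices: the quotient in the bound is at most `2 * (m - 1 + k).choose k`, by a termwise comparison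
of products (`prod_le_two_mul_pow_mul_choose`), and Pascal's rule leaves room for the other
terms (`choose_add_choose_add_choose_le`). For `χ = 3, 4` a single step with `p = χ - 1` gives
`|V| ≥ (χ - 1) * k + 1` (`SimpleGraph.mul_add_one_le_card_of_not_colorable`), which is enough.
-/

/-! ### Odd closed walks and odd cycles -/

namespace SimpleGraph

/-- A walk can be shortened to a path without changing the parity of its length, unless an odd cycle
gets cut off on the way. -/
theorem Walk.exists_isPath_even_add_or_odd_cycle {V : Type*} {G : SimpleGraph V} {u v : V}
    (p : G.Walk u v) :
    (∃ q : G.Walk u v, q.IsPath ∧ q.length ≤ p.length ∧ Even (p.length + q.length)) ∨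
      ∃ (x : V) (c : G.Walk x x), c.IsCycle ∧ Odd c.length ∧ c.length ≤ p.length := by
  classical
  induction p with
  | nil => exact Or.inl ⟨.nil, .nil, by simp, by simp⟩
  | @cons u x v h p ih =>
    rcases ih with ⟨q, hq, hle, hev⟩ | ⟨y, c, hc, hodd, hle⟩
    · by_cases hu : u ∈ q.support
      · have hlen : (q.takeUntil u hu).length + (q.dropUntil u hu).length = q.length := by
          rw [← Walk.length_append, Walk.take_spec]
        rcases Nat.even_or_odd (q.takeUntil u hu).length with ht | ht
        · right
          have h0 : (q.takeUntil u hu).length ≠ 0 := fun h0 =>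
            h.ne (Walk.eq_of_length_eq_zero h0).symm
          refine ⟨u, .cons h (q.takeUntil u hu), ?_, ?_, ?_⟩
          · rw [Walk.isCycle_iff_isPath_tail_and_le_length]
            refine ⟨by simpa using hq.takeUntil hu, ?_⟩
            rw [Walk.length_cons]; grind
          · rw [Walk.length_cons]; grind
          · rw [Walk.length_cons, Walk.length_cons]; omega
        · refine Or.inl ⟨q.dropUntil u hu, hq.dropUntil hu, ?_, ?_⟩
          · rw [Walk.length_cons]; omega
          · rw [Walk.length_cons]; grind
      · refine Or.inl ⟨.cons h q, hq.cons hu, ?_, ?_⟩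
        · rw [Walk.length_cons, Walk.length_cons]; omega
        · rw [Walk.length_cons, Walk.length_cons]; grind
    · exact Or.inr ⟨y, c, hc, hodd, hle.trans (by simp)⟩

theorem Walk.exists_odd_cycle_of_odd_length {V : Type*} {G : SimpleGraph V} {v : V}
    (p : G.Walk v v) (hp : Odd p.length) :
    ∃ (x : V) (c : G.Walk x x), c.IsCycle ∧ Odd c.length ∧ c.length ≤ p.length := by
  rcases Walk.exists_isPath_even_add_or_odd_cycle p with ⟨q, hq, -, hev⟩ | h
  · rw [Walk.isPath_iff_nil, ← Walk.length_eq_zero_iff] at hq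
    rw [hq, add_zero] at hev
    exact absurd hev (Nat.not_even_iff_odd.2 hp)
  · exact h

/-! ### Balls -/

open Classical in
/-- The closed ball: the vertices at distance at most `r` from `w`. The extended distance keeps
vertices of other components out, at which `SimpleGraph.dist` takes the value `0`. -/
noncomputable def closedBall {V : Type*} [Fintype V] (G : SimpleGraph V) (w : V) (r : ℕ) :
    Finset V := {u | G.edist w u ≤ r}

section
variable {V : Type*} [Fintype V] {G : SimpleGraph V} {w u v : V} {r k : ℕ}

theorem mem_closedBall : u ∈ closedBall G w r ↔ G.edist w u ≤ r := by simp [closedBall]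

theorem mem_closedBall_iff_dist : u ∈ closedBall G w r ↔ G.Reachable w u ∧ G.dist w u ≤ r := by
  rw [mem_closedBall]
  constructor
  · intro h
    have hr : G.Reachable w u := reachable_of_edist_ne_top (ne_top_of_le_ne_top (by simp) h)
    rw [← hr.coe_dist_eq_edist] at h
    exact ⟨hr, by exact_mod_cast h⟩
  · rintro ⟨hr, h⟩
    rw [← hr.coe_dist_eq_edist]
    exact_mod_cast h

theorem mem_closedBall_of_walk (p : G.Walk w u) (h : p.length ≤ r) : u ∈ closedBall G w r :=
  mem_closedBall.2 ((edist_le p).trans (by exact_mod_cast h))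

theorem self_mem_closedBall : w ∈ closedBall G w r := by simp [mem_closedBall]

theorem closedBall_subset_succ : closedBall G w r ⊆ closedBall G w (r + 1) := fun u hu =>
  mem_closedBall.2 ((mem_closedBall.1 hu).trans (by exact_mod_cast Nat.le_succ r))

theorem mem_closedBall_succ_of_adj (hu : u ∈ closedBall G w r) (h : G.Adj u v) :
    v ∈ closedBall G w (r + 1) := by
  obtain ⟨hr, hd⟩ := mem_closedBall_iff_dist.1 hu
  obtain ⟨p, hp⟩ := hr.exists_walk_length_eq_dist
  exact mem_closedBall_of_walk (p.concat h) (by rw [Walk.length_concat]; omega)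

/-- Within a ball of radius less than `k`, the parity of the distance to the centre is a proper
2-colouring: an edge violating this would close up two shortest paths to an odd walk of length at
most `2 * r + 1`. -/
theorem even_dist_iff_not_of_adj (hG : ∀ (x : V) (c : G.Walk x x), Odd c.length →
      2 * k + 1 ≤ c.length) (hr : r < k) (hu : u ∈ closedBall G w r) (hv : v ∈ closedBall G w r)
    (h : G.Adj u v) : Even (G.dist w u) ↔ ¬ Even (G.dist w v) := by
  obtain ⟨hru, hdu⟩ := mem_closedBall_iff_dist.1 hu
  obtain ⟨hrv, hdv⟩ := mem_closedBall_iff_dist.1 hv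
  obtain ⟨p, hp⟩ := hru.exists_walk_length_eq_dist
  obtain ⟨q, hq⟩ := hrv.exists_walk_length_eq_dist
  have := hG w ((p.concat h).append q.reverse)
  simp only [Walk.length_append, Walk.length_concat, Walk.length_reverse] at this
  grind

theorem dist_eq_of_adj_of_notMem (hu : u ∈ closedBall G w r) (hv : v ∉ closedBall G w r)
    (h : G.Adj u v) : G.dist w u = r := by
  obtain ⟨hru, hdu⟩ := mem_closedBall_iff_dist.1 hu
  by_contra hne
  obtain ⟨p, hp⟩ := hru.exists_walk_length_eq_dist
  exact hv (mem_closedBall_of_walk (p.concat h) (by rw [Walk.length_concat]; omega))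

end

/-! ### Partial colourings with a minimal uncoloured set -/

/-- The restriction of `c` to the complement of `W` is a proper colouring. The values of `c` on `W`
are irrelevant. -/
def ColorsOff {V : Type*} (G : SimpleGraph V) (W : Finset V) {p : ℕ} (c : V → Fin p) : Prop :=
  ∀ u ∉ W, ∀ v ∉ W, G.Adj u v → c u ≠ c v

section
variable {V : Type*} {G : SimpleGraph V} {p q k : ℕ} {W : Finset V} {c : V → Fin p}

theorem colorable_add_of_colorsOff (hc : ColorsOff G W c)
    (hW : (G.induce (W : Set V)).Colorable q) : G.Colorable (p + q) := by
  classical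
  obtain ⟨d⟩ := hW
  let e : V → Fin p ⊕ Fin q := fun v => if h : v ∈ W then .inr (d ⟨v, h⟩) else .inl (c v)
  have he : G.Coloring (Fin p ⊕ Fin q) := Coloring.mk e (by
    intro u v h
    by_cases hu : u ∈ W <;> by_cases hv : v ∈ W <;> simp only [e, hu, hv, dif_pos, dif_neg, ne_eq,
      not_false_eq_true, reduceCtorEq, Sum.inl.injEq, Sum.inr.injEq]
    · exact d.valid (show (G.induce (W : Set V)).Adj ⟨u, hu⟩ ⟨v, hv⟩ from h)
    · exact hc u hu v hv h)
  simpa using he.colorable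

theorem odd_walks_induce
    (hG : ∀ (x : V) (c : G.Walk x x), Odd c.length → 2 * k + 1 ≤ c.length) (s : Set V)
    (x : s) (c : (G.induce s).Walk x x) (h : Odd c.length) : 2 * k + 1 ≤ c.length := by
  have := hG _ (c.map (Embedding.induce s).toHom)
  rw [Walk.length_map] at this
  exact this h

variable [Fintype V]

theorem exists_minimal_colorsOff (G : SimpleGraph V) (hp : 0 < p) :
    ∃ (W : Finset V) (c : V → Fin p), ColorsOff G W c ∧
      ∀ (W' : Finset V) (c' : V → Fin p), ColorsOff G W' c' → W.card ≤ W'.card := by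
  classical
  have hne : ∃ n, ∃ (W : Finset V) (c : V → Fin p), ColorsOff G W c ∧ W.card = n :=
    ⟨_, Finset.univ, fun _ => ⟨0, hp⟩, fun u hu => absurd (Finset.mem_univ u) hu, rfl⟩
  obtain ⟨W, c, hc, hcard⟩ := Nat.find_spec hne
  exact ⟨W, c, hc, fun W' c' h' => hcard ▸ Nat.find_min' hne ⟨W', c', h', rfl⟩⟩

/-- The exchange argument: recolour the ball by the parity of the distance, with colour `j` on the
outermost layer, and uncolour instead the vertices of the next layer which have colour `j`. -/
theorem card_inter_closedBall_le (hp : 2 ≤ p)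
    (hG : ∀ (x : V) (c : G.Walk x x), Odd c.length → 2 * k + 1 ≤ c.length)
    (hc : ColorsOff G W c)
    (hmin : ∀ (W' : Finset V) (c' : V → Fin p), ColorsOff G W' c' → W.card ≤ W'.card)
    (w : V) {r : ℕ} (hr : r < k) (j : Fin p) [DecidableEq V] :
    (W ∩ closedBall G w r).card ≤
      {v ∈ (closedBall G w (r + 1) \ closedBall G w r) \ W | c v = j}.card := by
  set B := closedBall G w r with hB
  set T := {v ∈ (closedBall G w (r + 1) \ B) \ W | c v = j} with hT
  have : Nontrivial (Fin p) := Fin.nontrivial_iff_two_le.2 hp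
  obtain ⟨j', hj'⟩ := exists_ne j
  let c' : V → Fin p := fun v =>
    if v ∈ B then (if Even (G.dist w v) ↔ Even r then j else j') else c v
  -- the only edges leaving the ball start at distance exactly `r`, where the new colour is `j`
  have hout : ∀ u ∈ B, ∀ v ∉ B, v ∉ (W \ B) ∪ T → G.Adj u v → c' u ≠ c' v := by
    intro u hu v hv hvW h
    have hd := dist_eq_of_adj_of_notMem hu hv h
    have hv' := mem_closedBall_succ_of_adj hu h
    simp only [c', hu, hv, if_true, if_false, hd]
    simp only [hT, Finset.mem_union, Finset.mem_sdiff, Finset.mem_filter, not_or, not_and,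
      not_not] at hvW
    exact fun he => hvW.2 ⟨⟨hv', hv⟩, (fun hw => hv (hvW.1 hw))⟩ he.symm
  have hc' : ColorsOff G ((W \ B) ∪ T) c' := by
    intro u hu v hv h
    by_cases huB : u ∈ B <;> by_cases hvB : v ∈ B
    · have := even_dist_iff_not_of_adj hG hr huB hvB h
      simp only [c', huB, hvB, if_true]
      split_ifs with h1 h2 h2
      · exfalso; tauto
      · exact hj'.symm
      · exact hj'
      · exfalso; tauto
    · exact hout u huB v hvB hv h
    · exact (hout v hvB u huB hu h.symm).symm
    · simp only [c', huB, hvB, if_false]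
      refine hc u (fun hw => hu ?_) v (fun hw => hv ?_) h <;>
        exact Finset.mem_union_left _ (Finset.mem_sdiff.2 ⟨hw, ‹_›⟩)
  have h1 := hmin _ _ hc'
  have h2 := Finset.card_union_le (W \ B) T
  have h3 := Finset.card_inter_add_card_sdiff W B
  omega

/-- One growth step of a ball, from the exchange argument for all `p` colours. -/
theorem card_closedBall_sdiff_add_le (hp : 2 ≤ p)
    (hG : ∀ (x : V) (c : G.Walk x x), Odd c.length → 2 * k + 1 ≤ c.length)
    (hc : ColorsOff G W c)
    (hmin : ∀ (W' : Finset V) (c' : V → Fin p), ColorsOff G W' c' → W.card ≤ W'.card)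
    (w : V) {r : ℕ} (hr : r < k) [DecidableEq V] :
    (closedBall G w r \ W).card + p * (W ∩ closedBall G w r).card ≤
      (closedBall G w (r + 1) \ W).card := by
  have h1 : p * (W ∩ closedBall G w r).card ≤
      ((closedBall G w (r + 1) \ closedBall G w r) \ W).card := by
    calc p * (W ∩ closedBall G w r).card = ∑ _j : Fin p, (W ∩ closedBall G w r).card := by simp
      _ ≤ ∑ j : Fin p, {v ∈ (closedBall G w (r + 1) \ closedBall G w r) \ W | c v = j}.card :=
        Finset.sum_le_sum fun j _ => card_inter_closedBall_le hp hG hc hmin w hr j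
      _ = _ := (Finset.card_eq_sum_card_fiberwise fun _ _ => by simp).symm
  have h2 : (closedBall G w (r + 1) \ W).card =
      (closedBall G w r \ W).card +
        ((closedBall G w (r + 1) \ closedBall G w r) \ W).card := by
    rw [← Finset.card_union_of_disjoint]
    · congr 1
      ext v
      have := @closedBall_subset_succ V _ G w r v
      simp only [Finset.mem_union, Finset.mem_sdiff]
      tauto
    · refine Finset.disjoint_left.2 fun v hv hv' => ?_
      simp only [Finset.mem_sdiff] at hv hv'
      tauto
  omega

theorem card_closedBall_induce_le [DecidableEq V] (w : (W : Set V)) (r : ℕ) :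
    (closedBall (G.induce (W : Set V)) w r).card ≤ (W ∩ closedBall G w r).card := by
  rw [← Finset.card_map (Function.Embedding.subtype (fun v => v ∈ (W : Set V)))]
  refine Finset.card_le_card fun v hv => ?_
  obtain ⟨u, hu, rfl⟩ := Finset.mem_map.1 hv
  obtain ⟨hr, hd⟩ := mem_closedBall_iff_dist.1 hu
  obtain ⟨q, hq⟩ := hr.exists_walk_length_eq_dist
  refine Finset.mem_inter.2 ⟨u.2, ?_⟩
  exact mem_closedBall_of_walk (q.map (Embedding.induce (W : Set V)).toHom)
    ((Walk.length_map _ _).trans_le (hq.trans_le hd))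

end

/-! ### Lower bounds on the number of vertices -/

/-- The Pascal-type growth of balls, by induction on the number of colour pairs: the centre `w` comes
from the subgraph induced on a minimal set `W` with 2-colourable complement, and the trace of a ball
of `G` on `W` contains the ball of that subgraph. -/
theorem exists_two_mul_choose_le_card_closedBall (k m : ℕ) :
    ∀ {V : Type*} [Fintype V] (G : SimpleGraph V),
      (∀ (x : V) (c : G.Walk x x), Odd c.length → 2 * k + 1 ≤ c.length) →
      ¬ G.Colorable (2 * m) →
      ∃ w, ∀ r ≤ k, 2 * (m + r).choose r ≤ (closedBall G w r).card + 1 := by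
  classical
  induction m with
  | zero =>
    intro V _ G hG hcol
    have : Nonempty V := by
      by_contra hV
      rw [not_nonempty_iff] at hV
      exact hcol (Colorable.of_isEmpty _)
    refine ⟨Classical.arbitrary V, fun r _ => ?_⟩
    have := Finset.card_pos.2 ⟨_, self_mem_closedBall (G := G) (w := Classical.arbitrary V) (r := r)⟩
    rw [zero_add, Nat.choose_self]
    omega
  | succ m ih =>
    intro V _ G hG hcol
    obtain ⟨W, c, hc, hmin⟩ := exists_minimal_colorsOff G (p := 2) two_pos
    obtain ⟨w, hw⟩ := ih (G.induce (W : Set V)) (odd_walks_induce hG _)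
      (fun h => hcol ((colorable_add_of_colorsOff hc h).mono (by omega)))
    -- `hω` counts the part of the ball inside `W`, `hd` the part outside
    have hω : ∀ r ≤ k, 2 * (m + r).choose r ≤ (W ∩ closedBall G w r).card + 1 := fun r hr =>
      (hw r hr).trans (Nat.add_le_add_right (card_closedBall_induce_le w r) 1)
    have hd : ∀ r ≤ k, 2 * (m + 1 + r).choose r ≤
        (closedBall G (w : V) r \ W).card + 2 * (m + r).choose r := by
      intro r
      induction r with
      | zero => simp
      | succ r ihr =>
        intro hr
        have h1 := ihr (by omega)
        have h2 := hω r (by omega)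
        have h3 := card_closedBall_sdiff_add_le le_rfl hG hc hmin w (r := r) (by omega)
        have h4 : (m + 1 + (r + 1)).choose (r + 1) =
          (m + 1 + r).choose r + (m + (r + 1)).choose (r + 1) := by
          rw [show m + 1 + (r + 1) = (m + 1 + r) + 1 by ring, Nat.choose_succ_succ,
            show m + (r + 1) = m + 1 + r by ring]
        have h5 : 0 < (m + r).choose r := Nat.choose_pos (by omega)
        omega
    refine ⟨w, fun r hr => ?_⟩
    have h1 := hd r hr
    have h2 := hω r hr
    have h3 := Finset.card_inter_add_card_sdiff (closedBall G (w : V) r) W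
    rw [Finset.inter_comm] at h3
    omega

/-- A single growth step repeated `k` times around an uncoloured vertex; better than the binomial
bound when there are few colours. -/
theorem mul_add_one_le_card_of_not_colorable {V : Type*} [Fintype V] {G : SimpleGraph V} {k p : ℕ}
    (hG : ∀ (x : V) (c : G.Walk x x), Odd c.length → 2 * k + 1 ≤ c.length) (hp : 2 ≤ p)
    (hcol : ¬ G.Colorable p) : p * k + 1 ≤ Fintype.card V := by
  classical
  obtain ⟨W, c, hc, hmin⟩ := exists_minimal_colorsOff G (p := p) (by omega)
  have hW : W.Nonempty := by
    by_contra h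
    rw [Finset.not_nonempty_iff_eq_empty] at h
    subst h
    exact hcol ⟨Coloring.mk c fun {u v} h => hc u (by simp) v (by simp) h⟩
  obtain ⟨w, hw⟩ := hW
  have hpos : ∀ r, 1 ≤ (W ∩ closedBall G w r).card := fun r =>
    Finset.card_pos.2 ⟨w, Finset.mem_inter.2 ⟨hw, self_mem_closedBall⟩⟩
  have hd : ∀ r ≤ k, p * r ≤ (closedBall G w r \ W).card := by
    intro r
    induction r with
    | zero => simp
    | succ r ihr =>
      intro hr
      have h1 := ihr (by omega)
      have h3 := card_closedBall_sdiff_add_le hp hG hc hmin w (r := r) (by omega)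
      have h4 := Nat.mul_le_mul_left p (hpos r)
      rw [mul_add]
      omega
  have h1 := hd k le_rfl
  have h2 := hpos k
  have h3 := Finset.card_inter_add_card_sdiff (closedBall G w k) W
  have h4 := Finset.card_le_univ (closedBall G w k)
  rw [Finset.inter_comm] at h3
  omega

end SimpleGraph

/-! ### Comparison of products and binomial coefficients -/

theorem prod_le_two_mul_pow_mul_choose {a k : ℕ} (ha : 1 ≤ a) (hk : 2 ≤ k) :
    ∏ i ∈ Finset.range k, (2 * a + k + 2 + i) ≤ (2 * k) ^ k * (a + k).choose k := by
  refine Nat.le_of_mul_le_mul_left ?_ k.factorial_pos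
  have h : k.factorial * ((2 * k) ^ k * (a + k).choose k) =
      ∏ i ∈ Finset.range k, (2 * k * (a + 1 + i)) := by
    rw [Finset.prod_mul_distrib, ← Nat.ascFactorial_eq_prod_range,
      Nat.ascFactorial_eq_factorial_mul_choose]
    simp
    ring
  rw [h, ← Finset.prod_range_add_one_eq_factorial]
  obtain ⟨K, rfl⟩ : ∃ K, k = K + 1 := ⟨k - 1, by omega⟩
  -- the largest factor is paired with the smallest one of the factorial, the others in order
  rw [Finset.prod_range_succ' (fun i => i + 1), Finset.prod_range_succ,
    Finset.prod_range_succ' (fun i => 2 * (K + 1) * (a + 1 + i)), mul_mul_mul_comm,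
    ← Finset.prod_mul_distrib]
  refine Nat.mul_le_mul (Finset.prod_le_prod' fun i hi => ?_) ?_
  · have hi' : i + 1 ≤ K := Finset.mem_range.1 hi
    nlinarith [Nat.mul_le_mul_left (2 * a) hi', Nat.mul_le_mul_left (i + 2) hi']
  · nlinarith [Nat.mul_le_mul ha (show 1 ≤ K by omega)]

theorem prod_add_one_le {k : ℕ} (hk : 4 ≤ k) :
    ∏ i ∈ Finset.range k, (k + 1 + i) ≤ 2 ^ (k - 1) * k ^ k := by
  obtain ⟨K, rfl⟩ : ∃ K, k = K + 2 := ⟨k - 2, by omega⟩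
  -- the two smallest factors contribute the missing factor `1 / 2`, as `(k + 1) * (k + 2) ≤ 2 * k ^ 2`
  rw [Finset.prod_range_succ', Finset.prod_range_succ', mul_assoc]
  calc _ ≤ (2 * (K + 2)) ^ K * (2 * (K + 2) ^ 2) := by
        refine Nat.mul_le_mul ?_ (by nlinarith)
        refine (Finset.prod_le_pow_card _ _ (2 * (K + 2)) fun i hi => ?_).trans (by simp)
        have := Finset.mem_range.1 hi
        omega
    _ = _ := by rw [show K + 2 - 1 = K + 1 by omega, mul_pow]; ring

theorem prod_add_two_le {k : ℕ} (hk : 2 ≤ k) :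
    ∏ i ∈ Finset.range k, (k + 2 + i) ≤ (k + 1) * (2 ^ (k - 1) * k ^ k) := by
  obtain ⟨K, rfl⟩ : ∃ K, k = K + 1 := ⟨k - 1, by omega⟩
  rw [Finset.prod_range_succ]
  calc _ ≤ (2 * (K + 1)) ^ K * ((K + 1 + 1) * (K + 1)) := by
        refine Nat.mul_le_mul ?_ (by nlinarith)
        refine (Finset.prod_le_pow_card _ _ (2 * (K + 1)) fun i hi => ?_).trans (by simp)
        have := Finset.mem_range.1 hi
        omega
    _ = _ := by rw [show K + 1 - 1 = K by omega, mul_pow]; ring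

theorem choose_add_choose_add_choose_le {k m : ℕ} (hk : 2 ≤ k) (hm : 2 ≤ m) :
    2 * (m - 1 + k).choose k + 2 * (k - 2 + m).choose m + (k - 2 + m).choose (m - 1) + 2 ≤
      2 * (m + k).choose k := by
  obtain ⟨K, rfl⟩ : ∃ K, k = K + 2 := ⟨k - 2, by omega⟩
  obtain ⟨M, rfl⟩ : ∃ M, m = M + 2 := ⟨m - 2, by omega⟩
  have h1 : (M + 2 + (K + 2)).choose (K + 2) =
      (M + 1 + (K + 2)).choose (K + 2) + (M + 1 + (K + 2)).choose (M + 2) := by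
    rw [show M + 2 + (K + 2) = (M + 1 + (K + 2)) + 1 by ring, Nat.choose_succ_succ, add_comm,
      ← Nat.choose_symm_of_eq_add (show M + 1 + (K + 2) = (K + 1) + (M + 2) by ring)]
  have h2 : (M + 1 + (K + 2)).choose (M + 2) =
      (K + (M + 2)).choose (M + 1) + (K + (M + 2)).choose (M + 2) := by
    rw [show M + 1 + (K + 2) = (K + (M + 2)) + 1 by ring, Nat.choose_succ_succ]
  have h3 : (K + (M + 2)).choose (M + 1) =
      (K + (M + 1)).choose M + (K + (M + 1)).choose (M + 1) := by
    rw [show K + (M + 2) = (K + (M + 1)) + 1 by ring, Nat.choose_succ_succ]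
  have h4 : 0 < (K + (M + 1)).choose M := Nat.choose_pos (by omega)
  have h5 : 0 < (K + (M + 1)).choose (M + 1) := Nat.choose_pos (by omega)
  rw [show M + 2 - 1 = M + 1 by omega, show K + 2 - 2 = K by omega]
  omega

theorem cast_prod_div_le {k χ b : ℕ} (hk : 2 ≤ k)
    (h : ∏ i ∈ Finset.range k, (χ + k - 2 + i) ≤ b * (2 ^ (k - 1) * k ^ k)) :
    (∏ i ∈ Finset.range k, ((χ : ℝ) + (k : ℝ) - 2 + (i : ℝ))) / (2 ^ (k - 1) * (k : ℝ) ^ k) ≤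
      b := by
  have hk0 : (0 : ℝ) < k := by exact_mod_cast (by omega : 0 < k)
  rw [div_le_iff₀ (by positivity)]
  calc _ = ((∏ i ∈ Finset.range k, (χ + k - 2 + i) : ℕ) : ℝ) := by
        push_cast [show 2 ≤ χ + k by omega]
        rfl
    _ ≤ _ := by exact_mod_cast h

/-! ### The bound -/

theorem corollary2p2 {V : Type*} [Fintype V] (X : SimpleGraph V) (k χ : ℕ)
    (hk : 2 ≤ k) (hχ : 3 ≤ χ) (hkχ : χ = 3 → 4 ≤ k)
    (hodd : ∀ (v : V) (c : X.Walk v v), c.IsCycle → Odd c.length → 2 * k + 1 ≤ c.length)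
    (hchrom : X.chromaticNumber = (χ : ℕ∞)) :
    (∏ i ∈ Finset.range k, ((χ : ℝ) + (k : ℝ) - 2 + (i : ℝ))) / (2 ^ (k - 1) * (k : ℝ) ^ k)
      + 2 * (Nat.choose (k - 2 + (χ - 1) / 2) ((χ - 1) / 2) : ℝ)
      + (Nat.choose (k - 2 + (χ - 1) / 2) ((χ - 1) / 2 - 1) : ℝ)
      + 1 ≤ (Fintype.card V : ℝ) := by
  have hG : ∀ (x : V) (c : X.Walk x x), Odd c.length → 2 * k + 1 ≤ c.length := by
    intro x c hc
    obtain ⟨y, d, hd, hdo, hle⟩ := SimpleGraph.Walk.exists_odd_cycle_of_odd_length c hc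
    exact (hodd y d hd hdo).trans hle
  have hcol : ∀ p < χ, ¬ X.Colorable p := by
    intro p hp h
    have h1 := h.chromaticNumber_le
    rw [hchrom] at h1
    have : χ ≤ p := by exact_mod_cast h1
    omega
  suffices h : ∃ b : ℕ, ∏ i ∈ Finset.range k, (χ + k - 2 + i) ≤ b * (2 ^ (k - 1) * k ^ k) ∧
      b + 2 * (k - 2 + (χ - 1) / 2).choose ((χ - 1) / 2) +
        (k - 2 + (χ - 1) / 2).choose ((χ - 1) / 2 - 1) + 1 ≤ Fintype.card V by
    obtain ⟨b, h1, h2⟩ := h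
    have h3 := cast_prod_div_le hk h1
    have h4 : (b : ℝ) + 2 * ((k - 2 + (χ - 1) / 2).choose ((χ - 1) / 2) : ℝ) +
        ((k - 2 + (χ - 1) / 2).choose ((χ - 1) / 2 - 1) : ℝ) + 1 ≤ (Fintype.card V : ℝ) := by
      exact_mod_cast h2
    linarith
  -- `b` is the integer upper bound for the quotient
  obtain rfl | rfl | h5 : χ = 3 ∨ χ = 4 ∨ 5 ≤ χ := by omega
  · have hn := SimpleGraph.mul_add_one_le_card_of_not_colorable hG le_rfl (hcol 2 (by omega))
    refine ⟨1, ?_, ?_⟩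
    · have h := prod_add_one_le (hkχ rfl)
      rw [one_mul]
      convert h using 3
      omega
    · norm_num
      omega
  · have hn := SimpleGraph.mul_add_one_le_card_of_not_colorable hG (by norm_num) (hcol 3 (by omega))
    refine ⟨k + 1, ?_, ?_⟩
    · have h := prod_add_two_le hk
      convert h using 3
      omega
    · norm_num
      omega
  · set m := (χ - 1) / 2 with hm
    obtain ⟨w, hw⟩ := SimpleGraph.exists_two_mul_choose_le_card_closedBall k m X hG (hcol _ (by omega))
    have h1 := hw k le_rfl
    have h2 := Finset.card_le_univ (SimpleGraph.closedBall X w k)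
    have h3 := choose_add_choose_add_choose_le hk (m := m) (by omega)
    refine ⟨2 * (m - 1 + k).choose k, ?_, by omega⟩
    calc ∏ i ∈ Finset.range k, (χ + k - 2 + i)
        ≤ ∏ i ∈ Finset.range k, (2 * (m - 1) + k + 2 + i) :=
          Finset.prod_le_prod' fun i _ => by omega
      _ ≤ (2 * k) ^ k * (m - 1 + k).choose k :=
          prod_le_two_mul_pow_mul_choose (by omega) hk
      _ = _ := by
          obtain ⟨K, rfl⟩ : ∃ K, k = K + 1 := ⟨k - 1, by omega⟩
          rw [show K + 1 - 1 = K by omega, mul_pow]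
          ring
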